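/- **Setting.** Let $d, L$ be natural numbers. Let $\mathbb{X}$ be a probability distribution on $\mathbb{R}^d$ and let $f_{\mathrm{true}}:\mathbb{R}^d\to\mathbb{R}^L$ be measurable. Let $\mathbb{P}$ be the law of $(x,f_{\mathrm{true}}(x))$ with $x\sim\mathbb{X}$ (the clean distribution), and let $\mathbb{D}$ be a distribution on $\mathbb{R}^d\times\mathbb{R}^L$ whose $x$-marginal is $\mathbb{X}$ (the noisy distribution). Let $\ell(y,z)$ be a measurable real loss on $\mathbb{R}^L\times\mathbb{R}^L$ and let $w(x,y;\Theta)$ be a measurable real weight on $\mathbb{R}^d\times\mathbb{R}^L\times\mathbb{R}^{L\times d}$. The model is linear, $f(x;\Theta)=\Theta x$, with parameter space the unit Frobenius ball $\mathcal{B}=\{\Theta\in\mathbb{R}^{L\times d}:\|\Theta\|_F\le 1\}$. The clean risk is $R(\Theta)=\mathbb{E}_{(x,y)\sim\mathbb{P}}[\ell(y,\Theta x)]$. **Assumptions** (with parameters $R>0$, $M_\ell,L_\ell,B_\ell,M_w,L_w,B_w$). 1. $\|x\|_2\le R$ for every $x$ in the support of $\mathbb{X}$. 2. $z\mapsto\ell(y,z)$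 is convex on $\mathbb{R}^L$ for the label $y$ of every example in the support of $\mathbb{P}$ or of $\mathbb{D}$. 3. For the label $y$ of every example in the support of $\mathbb{D}$, $z\mapsto\ell(y,z)$ is twice differentiable, and $|\ell(y,z)|\le M_\ell$, $\|\nabla_z\ell(y,z)\|_2\le L_\ell$, $\|\nabla_z^2\ell(y,z)\|_2\le B_\ell$ for all $\|z\|_2\le R$. 4. For every $(x,y)$ in the support of $\mathbb{D}$, $\Theta\mapsto w(x,y;\Theta)$ is twice differentiable, and $|w|\le M_w$, $\|\nabla_\Theta w\|_F\le L_w$, $\|\nabla_\Theta^2 w\|_2\le B_w$ (operator norm on $\mathbb{R}^{Ld}$) for all $\Theta\in\mathcal{B}$. 5. $w$ is debiasing: for every $\Theta\in\mathcal{B}$ the expectations $\mathbb{E}_{(x,y)\sim\mathbb{D}}[w(x,y;\Theta)\,\ell(y,\Theta x)]$ and $R(\Theta)$ exist and are equal. **Algorithm.** Projected single-pass SGD with step sizes $\eta^{(t)}>0$ uses i.i.d. samples $(x^{(t)},y^{(t)})\sim\mathbb{D}$, starts at $\Theta^{(1)}=0$, and sets $$\Theta^{(t+1)}=\mathrm{proj}_{\mathcal{B}}\Bigl(\Theta^{(t)}-\eta^{(t)}\,\nabla_\Theta\bigl[w(x^{(t)},y^{(t)};\Theta)\,\ell(y^{(t)},\Theta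 x^{(t)})\bigr]_{\Theta=\Theta^{(t)}}\Bigr),$$ where $\mathrm{proj}_{\mathcal{B}}$ is Euclidean projection onto $\mathcal{B}$. The output is $\Theta^{(T)}$. **Theorem.** Put $\kappa=L_wM_\ell+R\,M_wL_\ell$. There is a universal constant $C>0$ such that for all values of the regularity parameters and every integer $T\ge 1$ there is a sequence of positive step sizes $(\eta^{(t)})$, depending only on $T$ and the regularity parameters, with the following property. For every $\epsilon>0$ with $T\ge C\kappa^2/\epsilon^2$, and for all $d$, $L$, $\mathbb{X}$, $f_{\mathrm{true}}$, $\mathbb{D}$, $\ell$, $w$ as above satisfying the assumptions with these parameters, $R$ attains its minimum over $\mathcal{B}$ and, with probability at least $99\%$ over the samples, $$R(\Theta^{(T)})\le\min_{\|\Theta\|_F\le 1}R(\Theta)+\epsilon .$$ -/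

import Mathlib

open MeasureTheory ProbabilityTheory
open scoped Gradient

namespace ReweightedSGD

noncomputable section

/-- Real `L × d` matrices, indexed by pairs; the Euclidean norm is the Frobenius norm and the
inner product is the entrywise one. -/
abbrev Param (L d : ℕ) : Type := EuclideanSpace ℝ (Fin L × Fin d)

/-- Labelled examples `(x, y)` with `x ∈ ℝ^d` and `y ∈ ℝ^L`. -/
abbrev Example (L d : ℕ) : Type := EuclideanSpace ℝ (Fin d) × EuclideanSpace ℝ (Fin L)

/-- The linear model `f(x; Θ) = Θ x`. -/
def model {L d : ℕ} (Θ : Param L d) (x : EuclideanSpace ℝ (Fin d)) : EuclideanSpace ℝ (Fin L) :=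
  WithLp.toLp 2 fun i => ∑ j, Θ (i, j) * x j

/-- The clean distribution: the law of `(x, fTrue x)` when `x` has law `X`. -/
def cleanDist {L d : ℕ} (X : Measure (EuclideanSpace ℝ (Fin d)))
    (fTrue : EuclideanSpace ℝ (Fin d) → EuclideanSpace ℝ (Fin L)) : Measure (Example L d) :=
  X.map fun x => (x, fTrue x)

/-- The population risk `R(Θ) = E_{(x, y) ∼ P} ℓ(y, Θ x)`. -/
def risk {L d : ℕ} (P : Measure (Example L d))
    (ℓ : EuclideanSpace ℝ (Fin L) → EuclideanSpace ℝ (Fin L) → ℝ) (Θ : Param L d) : ℝ :=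
  ∫ p, ℓ p.2 (model Θ p.1) ∂P

/-- The reweighted loss `w(x, y; Θ) ℓ(y, Θ x)` of one example. -/
def weightedLoss {L d : ℕ} (w : Example L d → Param L d → ℝ)
    (ℓ : EuclideanSpace ℝ (Fin L) → EuclideanSpace ℝ (Fin L) → ℝ)
    (p : Example L d) (Θ : Param L d) : ℝ :=
  w p Θ * ℓ p.2 (model Θ p.1)

/-- The reweighted risk `R^w(Θ) = E_{(x, y) ∼ D} [w(x, y; Θ) ℓ(y, Θ x)]`. -/
def weightedRisk {L d : ℕ} (D : Measure (Example L d)) (w : Example L d → Param L d → ℝ)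
    (ℓ : EuclideanSpace ℝ (Fin L) → EuclideanSpace ℝ (Fin L) → ℝ) (Θ : Param L d) : ℝ :=
  ∫ p, weightedLoss w ℓ p Θ ∂D

/-- `w` is a debiasing weight: for every parameter in the unit Frobenius ball both expectations
exist and the reweighted noisy risk equals the clean risk. -/
def IsDebiasing {L d : ℕ} (P D : Measure (Example L d)) (w : Example L d → Param L d → ℝ)
    (ℓ : EuclideanSpace ℝ (Fin L) → EuclideanSpace ℝ (Fin L) → ℝ) : Prop :=
  ∀ Θ : Param L d, ‖Θ‖ ≤ 1 →
    Integrable (fun p => ℓ p.2 (model Θ p.1)) P ∧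
    Integrable (fun p => weightedLoss w ℓ p Θ) D ∧
    weightedRisk D w ℓ Θ = risk P ℓ Θ

/-- `q` is twice differentiable and, on the closed ball of radius `r` around the origin, it is
bounded by `M`, its gradient by `K`, and its Hessian by `B` in operator norm. -/
structure IsRegular {ι : Type*} [Fintype ι] (q : EuclideanSpace ℝ ι → ℝ) (r M K B : ℝ) : Prop where
  differentiable : Differentiable ℝ q
  differentiable_gradient : Differentiable ℝ (∇ q)
  bounded : ∀ v, ‖v‖ ≤ r → |q v| ≤ M
  lipschitz : ∀ v, ‖v‖ ≤ r → ‖∇ q v‖ ≤ K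
  smooth : ∀ v, ‖v‖ ≤ r → ‖fderiv ℝ (∇ q) v‖ ≤ B

/-- The regularity parameters: radius of the feature domain, and bound, Lipschitz constant and
smoothness constant of the loss and of the weight. -/
structure RegularityParams where
  R : ℝ
  Mℓ : ℝ
  Lℓ : ℝ
  Bℓ : ℝ
  Mw : ℝ
  Lw : ℝ
  Bw : ℝ

/-- `κ = L_w M_ℓ + R M_w L_ℓ`. -/
def RegularityParams.kappa (c : RegularityParams) : ℝ :=
  c.Lw * c.Mℓ + c.R * c.Mw * c.Lℓ

/-- The regularity assumptions on the feature distribution `X`, the clean distribution `P`, the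
noisy distribution `D`, the loss `ℓ` and the weight `w`. -/
structure RegularityAssumptions {L d : ℕ} (c : RegularityParams)
    (X : Measure (EuclideanSpace ℝ (Fin d))) (P D : Measure (Example L d))
    (ℓ : EuclideanSpace ℝ (Fin L) → EuclideanSpace ℝ (Fin L) → ℝ)
    (w : Example L d → Param L d → ℝ) : Prop where
  radius_pos : 0 < c.R
  features_bounded : ∀ x ∈ X.support, ‖x‖ ≤ c.R
  loss_convex : ∀ p ∈ P.support ∪ D.support, ConvexOn ℝ Set.univ (ℓ p.2)
  loss_regular : ∀ p ∈ D.support, IsRegular (ℓ p.2) c.R c.Mℓ c.Lℓ c.Bℓ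
  weight_regular : ∀ p ∈ D.support, IsRegular (w p) 1 c.Mw c.Lw c.Bw

/-- Euclidean projection onto the closed unit ball. -/
def projBall {L d : ℕ} (v : Param L d) : Param L d := (max 1 ‖v‖)⁻¹ • v

/-- `projBall v` lies in the closed unit ball. -/
theorem norm_projBall_le {L d : ℕ} (v : Param L d) : ‖projBall v‖ ≤ 1 := by
  have h : (0 : ℝ) < max 1 ‖v‖ := lt_max_of_lt_left one_pos
  rw [projBall, norm_smul, Real.norm_of_nonneg (inv_nonneg.2 h.le), inv_mul_le_iff₀ h, mul_one]
  exact le_max_right _ _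

/-- `projBall v` is a nearest point to `v` in the closed unit ball. -/
theorem norm_sub_projBall_le {L d : ℕ} (v u : Param L d) (hu : ‖u‖ ≤ 1) :
    ‖v - projBall v‖ ≤ ‖v - u‖ := by
  rcases le_total ‖v‖ 1 with hv | hv
  · simp [projBall, max_eq_left hv]
  · have h0 : 0 < ‖v‖ := lt_of_lt_of_le one_pos hv
    have h1 : v - projBall v = (1 - ‖v‖⁻¹) • v := by
      rw [projBall, max_eq_right hv, sub_smul, one_smul]
    have h2 : 0 ≤ 1 - ‖v‖⁻¹ := sub_nonneg.2 (inv_le_one_of_one_le₀ hv)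
    have h3 : ‖v - projBall v‖ = ‖v‖ - 1 := by
      rw [h1, norm_smul, Real.norm_of_nonneg h2, sub_mul, one_mul, inv_mul_cancel₀ h0.ne']
    rw [h3]
    linarith [norm_sub_norm_le v u]

/-- Projected single-pass SGD on the reweighted loss with step sizes `η` and samples `z`:
`Θ^(1) = 0` and `Θ^(t+1) = proj (Θ^(t) - η^(t) ∇_Θ [w(z^(t); Θ) ℓ(y^(t), Θ x^(t))] at Θ^(t))`.
The index `0` is not used. -/
def sgd {L d : ℕ} (w : Example L d → Param L d → ℝ)
    (ℓ : EuclideanSpace ℝ (Fin L) → EuclideanSpace ℝ (Fin L) → ℝ)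
    (η : ℕ → ℝ) (z : ℕ → Example L d) : ℕ → Param L d
  | 0 => 0
  | 1 => 0
  | t + 2 =>
    projBall (sgd w ℓ η z (t + 1) -
      η (t + 1) • ∇ (weightedLoss w ℓ (z (t + 1))) (sgd w ℓ η z (t + 1)))

end

end ReweightedSGD

/-! A single reweighted loss need not be convex in Θ, but by debiasing its expectation is the clean
risk f, which is convex on the ball. Differentiating under the integral
(`integral_inner_gradientOn_le`) shows that the expected sample gradient is a subgradient of f, and
each sample gradient has norm at most κ. So the scheme is projected stochastic subgradient descent
on a convex κ-Lipschitz function.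

The output is the last iterate, so averaging is not available. Instead each iterate x_k is compared
with a moving point z_k, where z_0 = u is a minimizer and z_{k+1} mixes x_{k+1} into z_k with weight
1/(m+1-k). Both depend only on earlier samples, hence are independent of the current one. With step
sizes c(m+1-k) the one-step inequalities telescope (`last_gap_le_of_recursion`) and bound the
expected gap of x_m by 1/(cT²) + Tcκ², where T = m+1. Taking c = 1/(κT^{3/2}) gives 2κ/√T, which is
at most ε/100 when T ≥ 40000κ²/ε². Markov's inequality then gives probability 99%. -/

namespace ReweightedSGD

/-! ### Telescoping for the last iterate -/

/-- The numerical recursion behind the last-iterate bound for linearly decaying step sizes. -/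
theorem last_gap_le_of_recursion (m : ℕ) {c κ : ℝ} (hc : 0 < c) {a b d e : ℕ → ℝ}
    (ha : ∀ k, 0 ≤ a k) (hb0 : b 0 = 0) (hd : ∀ k, 0 ≤ d k) (he0 : e 0 ≤ 1)
    (hb : ∀ k < m, b (k + 1) ≤
      1 / ((m : ℝ) + 1 - k) * a (k + 1) + (1 - 1 / ((m : ℝ) + 1 - k)) * b k)
    (he : ∀ k < m, e (k + 1) = (1 - 1 / ((m : ℝ) + 1 - k)) ^ 2 * d k)
    (hstep : ∀ k ≤ m, d k ≤ e k - 2 * (c * ((m : ℝ) + 1 - k)) * (a k - b k) +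
      (c * ((m : ℝ) + 1 - k)) ^ 2 * κ ^ 2) :
    c * a m ≤ 1 / ((m : ℝ) + 1) ^ 2 + (m + 1) * c ^ 2 * κ ^ 2 := by
  -- With n = m+1-k, dividing the step inequality by n² turns the noise into the constant c²κ², and
  -- e (k+1)/(n-1)² = d k/n². The a-term of this potential cancels the share of a (k+1) in the bound
  -- on b (k+1).
  have key : ∀ k ≤ m, e k / ((m : ℝ) + 1 - k) ^ 2 + 2 * c * b k - 2 * c * a k / ((m : ℝ) + 2 - k) ≤
      1 / ((m : ℝ) + 1) ^ 2 + k * c ^ 2 * κ ^ 2 := by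
    intro k
    induction k with
    | zero =>
      intro _
      have h1 : e 0 / ((m : ℝ) + 1) ^ 2 ≤ 1 / ((m : ℝ) + 1) ^ 2 := by gcongr
      have h2 : 0 ≤ 2 * c * a 0 / ((m : ℝ) + 2) := by have := ha 0; positivity
      simp only [Nat.cast_zero, sub_zero, hb0]
      linarith
    | succ k ih =>
      intro hk
      have ih := ih (by omega)
      have hkm : (k : ℝ) + 1 ≤ m := by exact_mod_cast hk
      have hb := hb k (by omega)
      have he := he k (by omega)
      have hs := hstep k (by omega)
      obtain ⟨n, hn⟩ : ∃ n : ℝ, n = (m : ℝ) + 1 - k := ⟨_, rfl⟩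
      have hn2 : 2 ≤ n := by linarith
      have e1 : (m : ℝ) + 1 - ((k + 1 : ℕ) : ℝ) = n - 1 := by push_cast; linarith
      have e2 : (m : ℝ) + 2 - ((k + 1 : ℕ) : ℝ) = n := by push_cast; linarith
      have e3 : (m : ℝ) + 2 - k = n + 1 := by linarith
      rw [e1, e2, he]
      rw [e3] at ih
      rw [← hn] at hb hs ih ⊢
      have h1 : (1 - 1 / n) ^ 2 * d k / (n - 1) ^ 2 = d k / n ^ 2 := by
        have : n - 1 ≠ 0 := by linarith
        field_simp
      have h2 : d k / n ^ 2 ≤ e k / n ^ 2 - 2 * c / n * (a k - b k) + c ^ 2 * κ ^ 2 := by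
        rw [div_le_iff₀ (by positivity)]
        refine hs.trans (le_of_eq ?_)
        field_simp
      have h3 : 2 * c * b (k + 1) ≤ 2 * c * (1 / n * a (k + 1) + (1 - 1 / n) * b k) := by gcongr
      -- Here the choice of u as a minimizer enters: a ≥ 0 absorbs the mismatch between 1/(n+1) and
      -- 1/n.
      have h4 : 2 * c * a k / (n + 1) ≤ 2 * c * a k / n := by
        have := ha k
        gcongr
        linarith
      rw [h1]
      push_cast
      have h5 : 2 * c / n * (a k - b k) = 2 * c * a k / n - 2 * c * (1 / n * b k) := by ring
      have h6 : 2 * c * a (k + 1) / n = 2 * c * (1 / n * a (k + 1)) := by ring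
      rw [h5] at h2
      rw [h6]
      linarith
  -- One further step from the output, with d m ≥ 0, supplies 2c·a m; the potential at m takes back
  -- only c·a m.
  have h1 := key m le_rfl
  have h2 := hstep m le_rfl
  have h3 := hd m
  rw [show (m : ℝ) + 1 - m = 1 by ring] at h1 h2
  rw [show (m : ℝ) + 2 - m = 2 by ring] at h1
  linarith

/-! ### Projection, iterates and comparison points -/

variable {L d : ℕ}

theorem projBall_of_norm_le {v : Param L d} (hv : ‖v‖ ≤ 1) : projBall v = v := by
  simp [projBall, max_eq_left hv]

/-- Outside the ball, v - p is a nonnegative multiple of the unit vector p = `projBall v`, and ⟨p, p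
- u⟩ ≥ 0 by Cauchy–Schwarz. Expanding the square of (p - u) + (v - p) gives the bound. -/
theorem norm_projBall_sub_le (v u : Param L d) (hu : ‖u‖ ≤ 1) :
    ‖projBall v - u‖ ≤ ‖v - u‖ := by
  rcases le_total ‖v‖ 1 with hv | hv
  · rw [projBall_of_norm_le hv]
  · have h0 : 0 < ‖v‖ := lt_of_lt_of_le one_pos hv
    obtain ⟨p, hp⟩ : ∃ p, p = projBall v := ⟨_, rfl⟩
    have hvp : v = ‖v‖ • p := by
      rw [hp, projBall, max_eq_right hv, smul_smul, mul_inv_cancel₀ h0.ne', one_smul]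
    have hpn : ‖p‖ = 1 := by
      rw [hp, projBall, max_eq_right hv, norm_smul, norm_inv, norm_norm, inv_mul_cancel₀ h0.ne']
    rw [← hp]
    have hpu : 0 ≤ inner ℝ p (p - u) := by
      rw [inner_sub_right, real_inner_self_eq_norm_sq, hpn]
      have := (real_inner_le_norm p u).trans
        (mul_le_mul hpn.le hu (norm_nonneg _) zero_le_one)
      linarith
    have hdec : v - u = (p - u) + (‖v‖ - 1) • p := by
      conv_lhs => rw [hvp]
      rw [sub_smul, one_smul]
      abel
    have hsq : ‖p - u‖ ^ 2 ≤ ‖v - u‖ ^ 2 := by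
      rw [hdec, norm_add_sq_real, inner_smul_right, real_inner_comm]
      have := mul_nonneg (sub_nonneg.2 hv) hpu
      nlinarith [sq_nonneg ‖(‖v‖ - 1) • p‖]
    exact le_of_sq_le_sq hsq (norm_nonneg _)

theorem measurable_projBall : Measurable (projBall : Param L d → Param L d) := by
  unfold projBall
  fun_prop

/-- Projected iteration with gradient oracle `G`, started at the origin. -/
noncomputable def oracleIterate {E : Type*} (G : E → Param L d → Param L d) (η : ℕ → ℝ) (z : ℕ → E) :
    ℕ → Param L d
  | 0 => 0
  | k + 1 => projBall (oracleIterate G η z k - η k • G (z k) (oracleIterate G η z k))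

/-- The comparison points for the iteration `x`: convex combinations of `u` and of
the first iterates. -/
noncomputable def comparisonPoint (m : ℕ) (u : Param L d) (x : ℕ → Param L d) : ℕ → Param L d
  | 0 => u
  | k + 1 => (1 / ((m : ℝ) + 1 - k)) • x (k + 1) +
      (1 - 1 / ((m : ℝ) + 1 - k)) • comparisonPoint m u x k

theorem norm_oracleIterate_le {E : Type*} (G : E → Param L d → Param L d) (η : ℕ → ℝ)
    (z : ℕ → E) (k : ℕ) : ‖oracleIterate G η z k‖ ≤ 1 := by
  cases k with
  | zero => simp [oracleIterate]
  | succ k => exact norm_projBall_le _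

theorem weight_mem_Icc {m k : ℕ} (hk : k < m) :
    0 ≤ 1 / ((m : ℝ) + 1 - k) ∧ 0 ≤ 1 - 1 / ((m : ℝ) + 1 - k) := by
  have hkm : (k : ℝ) + 1 ≤ m := by exact_mod_cast hk
  have h1 : 1 ≤ (m : ℝ) + 1 - k := by linarith
  exact ⟨by positivity, sub_nonneg.2 (by rw [div_le_one (by linarith)]; exact h1)⟩

theorem norm_comparisonPoint_le {m : ℕ} {u : Param L d} (hu : ‖u‖ ≤ 1) {x : ℕ → Param L d}
    (hx : ∀ k, ‖x k‖ ≤ 1) {k : ℕ} (hk : k ≤ m) : ‖comparisonPoint m u x k‖ ≤ 1 := by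
  induction k with
  | zero => exact hu
  | succ k ih =>
    obtain ⟨h0, h1⟩ := weight_mem_Icc (Nat.lt_of_succ_le hk)
    have := convex_closedBall (0 : Param L d) 1 (mem_closedBall_zero_iff.2 (hx (k + 1)))
      (mem_closedBall_zero_iff.2 (ih (by omega))) h0 h1 (by ring)
    exact mem_closedBall_zero_iff.1 this

/-! ### Independence of the past and expected progress -/

section Trajectory

variable {E Ω : Type*} [MeasurableSpace E]

/-- The pair at time k uses only samples of index below k, which is what makes it independent of `Z
k`. The induction needs both components together, since the next comparison point uses the new
iterate. -/
theorem measurable_past {Z : ℕ → Ω → E} {G : E → Param L d → Param L d}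
    (hG : Measurable (Function.uncurry G)) (η : ℕ → ℝ) (m : ℕ) (u : Param L d) (k : ℕ) :
    Measurable[⨆ i ∈ Set.Iio k, MeasurableSpace.comap (Z i) inferInstance]
      (fun ω => (oracleIterate G η (fun i => Z i ω) k,
        comparisonPoint m u (oracleIterate G η fun i => Z i ω) k)) := by
  induction k with
  | zero =>
    simp only [oracleIterate, comparisonPoint]
    exact measurable_const
  | succ k ih =>
    have hle : (⨆ i ∈ Set.Iio k, MeasurableSpace.comap (Z i) inferInstance) ≤
        ⨆ i ∈ Set.Iio (k + 1), MeasurableSpace.comap (Z i) inferInstance :=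
      biSup_mono fun i (hi : i < k) => Nat.lt_succ_of_lt hi
    have ih := ih.mono hle le_rfl
    have hZ : Measurable[⨆ i ∈ Set.Iio (k + 1), MeasurableSpace.comap (Z i) inferInstance]
        (Z k) :=
      Measurable.mono (comap_measurable (Z k))
        (le_biSup (fun i => MeasurableSpace.comap (Z i) inferInstance) (Nat.lt_succ_self k)) le_rfl
    have hstep : Measurable fun q : E × Param L d × Param L d =>
        projBall (q.2.1 - η k • G q.1 q.2.1) :=
      measurable_projBall.comp ((measurable_fst.comp measurable_snd).sub
        ((hG.comp (measurable_fst.prodMk (measurable_fst.comp measurable_snd))).const_smul (η k)))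
    have hstep2 : Measurable fun q : E × Param L d × Param L d =>
        (projBall (q.2.1 - η k • G q.1 q.2.1),
          (1 / ((m : ℝ) + 1 - k)) • projBall (q.2.1 - η k • G q.1 q.2.1) +
            (1 - 1 / ((m : ℝ) + 1 - k)) • q.2.2) :=
      hstep.prodMk (by
        have h2 : Measurable fun q : E × Param L d × Param L d => q.2.2 := by fun_prop
        generalize 1 / ((m : ℝ) + 1 - k) = r
        exact (hstep.const_smul r).add (h2.const_smul (1 - r)))
    have hpair : Measurable[⨆ i ∈ Set.Iio (k + 1), MeasurableSpace.comap (Z i) inferInstance]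
        (fun ω => (Z k ω, oracleIterate G η (fun i => Z i ω) k,
          comparisonPoint m u (oracleIterate G η fun i => Z i ω) k)) := hZ.prodMk ih
    simp only [oracleIterate, comparisonPoint]
    have hf := hstep2.comp hpair
    exact hf

variable [MeasurableSpace Ω]

theorem indepFun_past {μ : Measure Ω} {Z : ℕ → Ω → E} (hZ : ∀ i, Measurable (Z i))
    (hind : iIndepFun Z μ) {S : Type*} [MeasurableSpace S] {Y : Ω → S} {k : ℕ}
    (hY : Measurable[⨆ i ∈ Set.Iio k, MeasurableSpace.comap (Z i) inferInstance] Y) :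
    IndepFun (Z k) Y μ := by
  have h := indep_iSup_of_disjoint (fun i => (hZ i).comap_le) hind
    (S := {k}) (T := Set.Iio k) (by simp)
  rw [iSup_singleton] at h
  exact indep_of_indep_of_le_right h hY.comap_le

/-- Independence makes the joint law a product, so Fubini allows averaging over the fresh sample
with the past frozen. -/
theorem integral_comp_of_indepFun {μ : Measure Ω} [IsProbabilityMeasure μ] {S : Type*}
    [MeasurableSpace S] {ζ : Ω → E} {Y : Ω → S} (hζ : Measurable ζ) (hY : Measurable Y)
    (hind : IndepFun ζ Y μ) {h : E × S → ℝ} (hh : Measurable h)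
    (hint : Integrable (fun ω => h (ζ ω, Y ω)) μ) :
    ∫ ω, h (ζ ω, Y ω) ∂μ = ∫ ω, ∫ p, h (p, Y ω) ∂(μ.map ζ) ∂μ := by
  have hpair : Measurable fun ω => (ζ ω, Y ω) := hζ.prodMk hY
  have := Measure.isProbabilityMeasure_map (μ := μ) hζ.aemeasurable
  have := Measure.isProbabilityMeasure_map (μ := μ) hY.aemeasurable
  have hmap : μ.map (fun ω => (ζ ω, Y ω)) = (μ.map ζ).prod (μ.map Y) :=
    (indepFun_iff_map_prod_eq_prod_map_map hζ.aemeasurable hY.aemeasurable).1 hind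
  have hint' : Integrable h ((μ.map ζ).prod (μ.map Y)) := by
    rw [← hmap]
    exact (integrable_map_measure hh.aestronglyMeasurable hpair.aemeasurable).2 hint
  have h1 : ∫ ω, h (ζ ω, Y ω) ∂μ = ∫ q, h q ∂(μ.map fun ω => (ζ ω, Y ω)) :=
    (integral_map hpair.aemeasurable hh.aestronglyMeasurable).symm
  rw [h1, hmap, integral_prod_symm _ hint']
  exact integral_map hY.aemeasurable
    (hh.stronglyMeasurable.integral_prod_left' (μ := μ.map ζ)).aestronglyMeasurable

theorem norm_step_sub_sq_le {x g z : Param L d} {κ s : ℝ} (hg : ‖g‖ ≤ κ) (hz : ‖z‖ ≤ 1) :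
    ‖projBall (x - s • g) - z‖ ^ 2 ≤ ‖x - z‖ ^ 2 + 2 * s * inner ℝ g (z - x) + s ^ 2 * κ ^ 2 := by
  have h1 : ‖projBall (x - s • g) - z‖ ^ 2 ≤ ‖(x - z) - s • g‖ ^ 2 := by
    rw [sub_right_comm]
    have := norm_projBall_sub_le (x - s • g) z hz
    gcongr
  have h2 : ‖s • g‖ ^ 2 ≤ s ^ 2 * κ ^ 2 := by
    rw [norm_smul, mul_pow, Real.norm_eq_abs, sq_abs]
    gcongr
  rw [norm_sub_sq_real (x - z), inner_smul_right] at h1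
  have h3 : inner ℝ (x - z) g = - inner ℝ g (z - x) := by
    rw [← inner_neg_right, neg_sub, real_inner_comm]
  rw [h3] at h1
  linarith

/-- Expected suboptimality of the last iterate of projected stochastic gradient descent with
linearly decaying step sizes. -/
theorem expected_last_gap_le {μ : Measure Ω} [IsProbabilityMeasure μ] {D : Measure E}
    {Z : ℕ → Ω → E} (hZ : ∀ i, Measurable (Z i)) (hlaw : ∀ i, μ.map (Z i) = D)
    (hind : iIndepFun Z μ) {G : E → Param L d → Param L d}
    (hG : Measurable (Function.uncurry G)) {κ : ℝ} (hGκ : ∀ p v, ‖v‖ ≤ 1 → ‖G p v‖ ≤ κ)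
    {f : Param L d → ℝ} (hf : Measurable f) {B : ℝ} (hfB : ∀ v, ‖v‖ ≤ 1 → |f v| ≤ B)
    (hconv : ConvexOn ℝ (Metric.closedBall 0 1) f)
    (hsub : ∀ a b, ‖a‖ ≤ 1 → ‖b‖ ≤ 1 → ∫ p, inner ℝ (G p a) (b - a) ∂D ≤ f b - f a)
    {u : Param L d} (hu : ‖u‖ ≤ 1) (hmin : ∀ v, ‖v‖ ≤ 1 → f u ≤ f v) (m : ℕ) {c : ℝ} (hc : 0 < c)
    {η : ℕ → ℝ} (hη : ∀ k ≤ m, η k = c * ((m : ℝ) + 1 - k)) :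
    c * (∫ ω, f (oracleIterate G η (fun i => Z i ω) m) ∂μ - f u) ≤
      1 / ((m : ℝ) + 1) ^ 2 + (m + 1) * c ^ 2 * κ ^ 2 := by
  obtain ⟨x, hx⟩ : ∃ x : ℕ → Ω → Param L d, x = fun k ω => oracleIterate G η (fun i => Z i ω) k :=
    ⟨_, rfl⟩
  obtain ⟨z, hz⟩ : ∃ z : ℕ → Ω → Param L d,
      z = fun k ω => comparisonPoint m u (oracleIterate G η fun i => Z i ω) k := ⟨_, rfl⟩
  have hpast : ∀ k, Measurable[⨆ i ∈ Set.Iio k, MeasurableSpace.comap (Z i) inferInstance]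
      (fun ω => (x k ω, z k ω)) := fun k => by
    subst hx hz
    exact measurable_past hG η m u k
  have hsup : ∀ k, (⨆ i ∈ Set.Iio k, MeasurableSpace.comap (Z i) inferInstance) ≤
      (inferInstance : MeasurableSpace Ω) := fun k => iSup₂_le fun i _ => (hZ i).comap_le
  have hxz : ∀ k, Measurable (fun ω => (x k ω, z k ω)) := fun k => (hpast k).mono (hsup k) le_rfl
  have hxm : ∀ k, Measurable (x k) := fun k => measurable_fst.comp (hxz k)
  have hzm : ∀ k, Measurable (z k) := fun k => measurable_snd.comp (hxz k)
  have hx1 : ∀ k ω, ‖x k ω‖ ≤ 1 := fun k ω => by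
    subst hx
    exact norm_oracleIterate_le _ _ _ _
  have hz1 : ∀ k ≤ m, ∀ ω, ‖z k ω‖ ≤ 1 := fun k hk ω => by
    subst hz
    exact norm_comparisonPoint_le hu (fun _ => norm_oracleIterate_le _ _ _ _) hk
  have hx0 : ∀ ω, x 0 ω = 0 := fun ω => by subst hx; rfl
  have hz0 : ∀ ω, z 0 ω = u := fun ω => by subst hz; rfl
  have hxs : ∀ k ω, x (k + 1) ω = projBall (x k ω - η k • G (Z k ω) (x k ω)) := fun k ω => by
    subst hx; rfl
  have hzs : ∀ k ω, z (k + 1) ω = (1 / ((m : ℝ) + 1 - k)) • x (k + 1) ω +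
      (1 - 1 / ((m : ℝ) + 1 - k)) • z k ω := fun k ω => by subst hx hz; rfl
  have hfx : ∀ k, Integrable (fun ω => f (x k ω)) μ := fun k =>
    Integrable.of_bound (hf.comp (hxm k)).aestronglyMeasurable B
      (ae_of_all _ fun ω => hfB _ (hx1 k ω))
  have hfz : ∀ k ≤ m, Integrable (fun ω => f (z k ω)) μ := fun k hk =>
    Integrable.of_bound (hf.comp (hzm k)).aestronglyMeasurable B
      (ae_of_all _ fun ω => hfB _ (hz1 k hk ω))
  have hsq : ∀ j, ∀ k ≤ m, Integrable (fun ω => ‖x j ω - z k ω‖ ^ 2) μ := fun j k hk => by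
    refine Integrable.of_bound
      (((hxm j).sub (hzm k)).norm.pow_const 2).aestronglyMeasurable 4 (ae_of_all _ fun ω => ?_)
    have h1 : ‖x j ω - z k ω‖ ≤ 2 := (norm_sub_le _ _).trans
      (by linarith [hx1 j ω, hz1 k hk ω])
    rw [Real.norm_of_nonneg (by positivity)]
    nlinarith [norm_nonneg (x j ω - z k ω)]
  -- The comparison point is random, so the subgradient inequality is applied after freezing the
  -- past and then integrated.
  have hinner : ∀ k ≤ m, Integrable
      (fun ω => inner ℝ (G (Z k ω) (x k ω)) (z k ω - x k ω)) μ ∧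
      ∫ ω, inner ℝ (G (Z k ω) (x k ω)) (z k ω - x k ω) ∂μ ≤
        ∫ ω, f (z k ω) ∂μ - ∫ ω, f (x k ω) ∂μ := fun k hk => by
    have hh : Measurable fun q : E × Param L d × Param L d =>
        (inner ℝ (G q.1 q.2.1) (q.2.2 - q.2.1) : ℝ) :=
      Measurable.inner (hG.comp (measurable_fst.prodMk (measurable_fst.comp measurable_snd)))
        (by fun_prop)
    have hbd : ∀ p ω, ‖(inner ℝ (G p (x k ω)) (z k ω - x k ω) : ℝ)‖ ≤ κ * 2 := fun p ω => by
      refine (norm_inner_le_norm _ _).trans ?_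
      have h1 := hGκ p _ (hx1 k ω)
      have h2 : ‖z k ω - x k ω‖ ≤ 2 := (norm_sub_le _ _).trans
        (by linarith [hx1 k ω, hz1 k hk ω])
      exact mul_le_mul h1 h2 (norm_nonneg _) ((norm_nonneg _).trans h1)
    have hint : Integrable (fun ω => inner ℝ (G (Z k ω) (x k ω)) (z k ω - x k ω)) μ := by
      refine Integrable.of_bound
        (hh.comp ((hZ k).prodMk (hxz k))).aestronglyMeasurable (κ * 2) (ae_of_all _ fun ω => ?_)
      exact hbd _ ω
    refine ⟨hint, ?_⟩
    rw [integral_comp_of_indepFun (hZ k) (hxz k) (indepFun_past hZ hind (hpast k)) hh hint, hlaw k,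
      ← integral_sub (hfz k hk) (hfx k)]
    have : IsProbabilityMeasure D := hlaw k ▸ Measure.isProbabilityMeasure_map (hZ k).aemeasurable
    refine integral_mono (Integrable.of_bound ((hh.stronglyMeasurable.integral_prod_left'
      (μ := D)).measurable.comp (hxz k)).aestronglyMeasurable (κ * 2) (ae_of_all _ fun ω => ?_))
      ((hfz k hk).sub (hfx k)) fun ω => hsub _ _ (hx1 k ω) (hz1 k hk ω)
    refine (norm_integral_le_of_norm_le_const (ae_of_all _ fun p => hbd p ω)).trans ?_
    simp
  -- `d` measures the new iterate against the old comparison point, `e` both at the same time.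
  have hmain := last_gap_le_of_recursion m hc (κ := κ)
    (a := fun k => ∫ ω, f (x k ω) ∂μ - f u) (b := fun k => ∫ ω, f (z k ω) ∂μ - f u)
    (d := fun k => ∫ ω, ‖x (k + 1) ω - z k ω‖ ^ 2 ∂μ)
    (e := fun k => ∫ ω, ‖x k ω - z k ω‖ ^ 2 ∂μ)
    (fun k => ?_) (by simp [hz0]) (fun k => integral_nonneg fun ω => by positivity) ?_ ?_ ?_ ?_
  · simpa only [hx] using hmain
  · have := integral_mono (integrable_const (f u)) (hfx k) fun ω => hmin _ (hx1 k ω)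
    simpa using this
  · have h1 : ‖u‖ ^ 2 ≤ 1 := pow_le_one₀ (norm_nonneg _) hu
    simpa [hz0, hx0] using h1
  · intro k hk
    obtain ⟨h0, h1⟩ := weight_mem_Icc hk
    have h2 : ∫ ω, f (z (k + 1) ω) ∂μ ≤ ∫ ω, (1 / ((m : ℝ) + 1 - k) * f (x (k + 1) ω) +
        (1 - 1 / ((m : ℝ) + 1 - k)) * f (z k ω)) ∂μ := by
      refine integral_mono (hfz _ (by omega))
        (((hfx _).const_mul _).add ((hfz k (by omega)).const_mul _)) fun ω => ?_
      dsimp only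
      rw [hzs]
      exact hconv.2 (mem_closedBall_zero_iff.2 (hx1 _ ω))
        (mem_closedBall_zero_iff.2 (hz1 k (by omega) ω)) h0 h1 (by ring)
    rw [integral_add ((hfx _).const_mul _) ((hfz k (by omega)).const_mul _),
      integral_const_mul, integral_const_mul] at h2
    linarith
  · intro k hk
    rw [← integral_const_mul]
    congr 1 with ω
    have h1 : x (k + 1) ω - z (k + 1) ω =
        (1 - 1 / ((m : ℝ) + 1 - k)) • (x (k + 1) ω - z k ω) := by
      rw [hzs]
      module
    rw [h1, norm_smul, mul_pow, Real.norm_eq_abs, sq_abs]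
  · intro k hk
    obtain ⟨hi1, hi2⟩ := hinner k hk
    rw [← hη k hk]
    have hη0 : 0 ≤ η k := by
      have : (k : ℝ) ≤ m := by exact_mod_cast hk
      rw [hη k hk]
      exact mul_nonneg hc.le (by linarith)
    have hadd : Integrable (fun ω => ‖x k ω - z k ω‖ ^ 2 +
        2 * η k * inner ℝ (G (Z k ω) (x k ω)) (z k ω - x k ω)) μ :=
      (hsq k k hk).add (hi1.const_mul _)
    have h1 : ∫ ω, ‖x (k + 1) ω - z k ω‖ ^ 2 ∂μ ≤ ∫ ω, (‖x k ω - z k ω‖ ^ 2 +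
        2 * η k * inner ℝ (G (Z k ω) (x k ω)) (z k ω - x k ω) + η k ^ 2 * κ ^ 2) ∂μ := by
      refine integral_mono (hsq _ k hk)
        (hadd.add (integrable_const _)) fun ω => ?_
      dsimp only
      rw [hxs]
      exact norm_step_sub_sq_le (hGκ _ _ (hx1 k ω)) (hz1 k hk ω)
    rw [integral_add hadd (integrable_const _),
      integral_add (hsq k k hk) (hi1.const_mul _), integral_const_mul] at h1
    simp only [integral_const, probReal_univ, one_smul] at h1
    have h2 := mul_le_mul_of_nonneg_left hi2 (mul_nonneg zero_le_two hη0)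
    linarith

end Trajectory

/-! ### The linear model and the gradient bound κ -/

theorem norm_model_le (Θ : Param L d) (x : EuclideanSpace ℝ (Fin d)) :
    ‖model Θ x‖ ≤ ‖Θ‖ * ‖x‖ := by
  refine le_of_sq_le_sq ?_ (by positivity)
  rw [mul_pow, EuclideanSpace.real_norm_sq_eq, EuclideanSpace.real_norm_sq_eq,
    EuclideanSpace.real_norm_sq_eq, Fintype.sum_prod_type, Finset.sum_mul]
  exact Finset.sum_le_sum fun i _ =>
    Finset.sum_mul_sq_le_sq_mul_sq Finset.univ (fun j => Θ (i, j)) fun j => x j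

theorem model_add (Θ Θ' : Param L d) (x : EuclideanSpace ℝ (Fin d)) :
    model (Θ + Θ') x = model Θ x + model Θ' x := by
  ext i
  simp [model, add_mul, Finset.sum_add_distrib]

theorem model_smul (r : ℝ) (Θ : Param L d) (x : EuclideanSpace ℝ (Fin d)) :
    model (r • Θ) x = r • model Θ x := by
  ext i
  simp [model, Finset.mul_sum, mul_assoc]

/-- The model as a linear function of its parameter. -/
noncomputable def modelCLM (x : EuclideanSpace ℝ (Fin d)) :
    Param L d →L[ℝ] EuclideanSpace ℝ (Fin L) :=
  LinearMap.mkContinuous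
    { toFun := fun Θ => model Θ x
      map_add' := fun Θ Θ' => model_add Θ Θ' x
      map_smul' := fun r Θ => model_smul r Θ x } ‖x‖
    fun Θ => (norm_model_le Θ x).trans_eq (mul_comm _ _)

theorem measurable_model :
    Measurable fun q : Param L d × EuclideanSpace ℝ (Fin d) => model q.1 q.2 := by
  unfold model
  refine (WithLp.measurable_toLp 2 _).comp (measurable_pi_lambda _ fun i => ?_)
  refine Finset.measurable_sum _ fun j _ => ?_
  fun_prop

theorem norm_gradient (q : Param L d → ℝ) (v : Param L d) : ‖∇ q v‖ = ‖fderiv ℝ q v‖ := by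
  rw [← toDual_gradient, LinearIsometryEquiv.norm_map]

theorem inner_gradient (q : Param L d → ℝ) (v h : Param L d) :
    inner ℝ (∇ q v) h = fderiv ℝ q v h := by
  rw [← toDual_gradient, InnerProductSpace.toDual_apply_apply]

section Loss

variable {w : Example L d → Param L d → ℝ}
  {ℓ : EuclideanSpace ℝ (Fin L) → EuclideanSpace ℝ (Fin L) → ℝ} {p : Example L d}
  {c : RegularityParams}

theorem hasFDerivAt_weightedLoss (hw : Differentiable ℝ (w p)) (hℓ : Differentiable ℝ (ℓ p.2))
    (Θ : Param L d) :
    HasFDerivAt (weightedLoss w ℓ p)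
      (w p Θ • (fderiv ℝ (ℓ p.2) (model Θ p.1)).comp (modelCLM p.1) +
        ℓ p.2 (model Θ p.1) • fderiv ℝ (w p) Θ) Θ :=
  (hw Θ).hasFDerivAt.mul
    (HasFDerivAt.comp (g := ℓ p.2) Θ (hℓ (model Θ p.1)).hasFDerivAt (modelCLM p.1).hasFDerivAt)

/-- Product and chain rules: Θ ↦ Θx has operator norm at most R, and ‖Θx‖ ≤ R keeps the prediction
where the loss bounds hold. -/
theorem norm_gradient_weightedLoss_le (hw : IsRegular (w p) 1 c.Mw c.Lw c.Bw)
    (hℓ : IsRegular (ℓ p.2) c.R c.Mℓ c.Lℓ c.Bℓ) (hp : ‖p.1‖ ≤ c.R) {Θ : Param L d}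
    (hΘ : ‖Θ‖ ≤ 1) : ‖∇ (weightedLoss w ℓ p) Θ‖ ≤ c.kappa := by
  have hm : ‖model Θ p.1‖ ≤ c.R :=
    (norm_model_le Θ p.1).trans ((mul_le_of_le_one_left (norm_nonneg _) hΘ).trans hp)
  have hcl : ‖modelCLM (L := L) p.1‖ ≤ c.R :=
    (LinearMap.mkContinuous_norm_le _ (norm_nonneg _) _).trans hp
  have h1 := hw.bounded Θ hΘ
  have h2 := hw.lipschitz Θ hΘ
  have h3 := hℓ.bounded _ hm
  have h4 := hℓ.lipschitz _ hm
  rw [norm_gradient] at h2 ⊢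
  have h4' : ‖fderiv ℝ (ℓ p.2) (model Θ p.1)‖ ≤ c.Lℓ := by
    rwa [← toDual_gradient, LinearIsometryEquiv.norm_map]
  have hR : 0 ≤ c.R := (norm_nonneg _).trans hp
  have hMw : 0 ≤ c.Mw := (abs_nonneg _).trans h1
  have hMl : 0 ≤ c.Mℓ := (abs_nonneg _).trans h3
  have hLl : 0 ≤ c.Lℓ := (norm_nonneg _).trans h4
  rw [(hasFDerivAt_weightedLoss hw.differentiable hℓ.differentiable Θ).fderiv]
  refine (norm_add_le _ _).trans ?_
  rw [norm_smul, norm_smul, Real.norm_eq_abs, Real.norm_eq_abs]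
  have h5 : ‖(fderiv ℝ (ℓ p.2) (model Θ p.1)).comp (modelCLM (L := L) p.1)‖ ≤ c.Lℓ * c.R :=
    (ContinuousLinearMap.opNorm_comp_le _ _).trans (by gcongr)
  have h6 : |w p Θ| * ‖(fderiv ℝ (ℓ p.2) (model Θ p.1)).comp (modelCLM (L := L) p.1)‖ ≤
      c.Mw * (c.Lℓ * c.R) := by gcongr
  have h7 : |ℓ p.2 (model Θ p.1)| * ‖fderiv ℝ (w p) Θ‖ ≤ c.Mℓ * c.Lw := by gcongr
  rw [RegularityParams.kappa]
  linarith

end Loss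

/-- Transfers the feature bound, assumed on the support of the marginal, to examples in the support
of D. -/
theorem fst_mem_support_map {D : Measure (Example L d)} {p : Example L d} (hp : p ∈ D.support) :
    p.1 ∈ (D.map Prod.fst).support := by
  rw [Measure.mem_support_iff_forall] at hp ⊢
  intro U hU
  exact (hp _ (continuous_fst.continuousAt.preimage_mem_nhds hU)).trans_le
    (Measure.le_map_apply measurable_fst.aemeasurable U)

/-! ### The expected gradient as a subgradient -/

section Oracle

variable {E : Type*}

/-- The gradient of the sample loss `g p`, replaced by zero for samples outside `S`. -/
noncomputable def gradientOn (S : Set E) (g : E → Param L d → ℝ) (p : E) (v : Param L d) :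
    Param L d := S.indicator (fun p => ∇ (g p) v) p

theorem norm_gradientOn_le {S : Set E} {g : E → Param L d → ℝ} {κ : ℝ} (hκ0 : 0 ≤ κ)
    (hκ : ∀ p ∈ S, ∀ v, ‖v‖ ≤ 1 → ‖∇ (g p) v‖ ≤ κ) (p : E) {v : Param L d} (hv : ‖v‖ ≤ 1) :
    ‖gradientOn S g p v‖ ≤ κ := by
  by_cases hp : p ∈ S
  · simpa [gradientOn, hp] using hκ p hp v hv
  · simpa [gradientOn, hp] using hκ0

variable [MeasurableSpace E]

/-- Each coordinate is a pointwise limit of jointly measurable difference quotients. Cutting off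
outside S makes the limit exist everywhere. -/
theorem measurable_gradientOn {S : Set E} (hS : MeasurableSet S) {g : E → Param L d → ℝ}
    (hg : Measurable (Function.uncurry g)) (hdiff : ∀ p ∈ S, Differentiable ℝ (g p)) :
    Measurable (Function.uncurry (gradientOn S g)) := by
  have hcoord : ∀ i, Measurable fun q : E × Param L d => gradientOn S g q.1 q.2 i := by
    intro i
    refine measurable_of_tendsto_metrizable (f := fun (n : ℕ) (q : E × Param L d) =>
      (Prod.fst ⁻¹' S).indicator (fun q => (n : ℝ) •
        (g q.1 (q.2 + (n : ℝ)⁻¹ • EuclideanSpace.single i (1 : ℝ)) - g q.1 q.2)) q)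
      (fun n => ?_) ?_
    · refine Measurable.indicator (Measurable.const_smul (Measurable.sub ?_ hg) (n : ℝ))
        (measurable_fst hS)
      exact hg.comp (measurable_fst.prodMk (measurable_snd.add_const _))
    · rw [tendsto_pi_nhds]
      rintro ⟨p, v⟩
      by_cases hp : p ∈ S
      · have h1 := ((hdiff p hp v).hasFDerivAt.lim_real
          (EuclideanSpace.single i (1 : ℝ))).comp tendsto_natCast_atTop_atTop
        rw [← inner_gradient, EuclideanSpace.inner_single_right] at h1
        simpa [gradientOn, hp, Function.comp_def] using h1
      · simp [gradientOn, hp]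
  exact (WithLp.measurable_toLp 2 _).comp (measurable_pi_lambda _ hcoord)

theorem abs_sub_le_of_norm_gradient_le {q : Param L d → ℝ} (hq : Differentiable ℝ q) {κ : ℝ}
    (hκ : ∀ v, ‖v‖ ≤ 1 → ‖∇ q v‖ ≤ κ) {a b : Param L d} (ha : ‖a‖ ≤ 1) (hb : ‖b‖ ≤ 1) :
    |q b - q a| ≤ κ * ‖b - a‖ := by
  refine (convex_closedBall (0 : Param L d) 1).norm_image_sub_le_of_norm_fderiv_le
    (fun v _ => hq v) (fun v hv => ?_) (mem_closedBall_zero_iff.2 ha) (mem_closedBall_zero_iff.2 hb)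
  rw [← norm_gradient]
  exact hκ v (mem_closedBall_zero_iff.1 hv)

variable {D : Measure E} [IsProbabilityMeasure D] {S : Set E} {g : E → Param L d → ℝ} {κ : ℝ}
  {f : Param L d → ℝ}

theorem abs_expectation_sub_le (hS : S ∈ ae D) (hdiff : ∀ p ∈ S, Differentiable ℝ (g p))
    (hκ : ∀ p ∈ S, ∀ v, ‖v‖ ≤ 1 → ‖∇ (g p) v‖ ≤ κ)
    (hint : ∀ v, ‖v‖ ≤ 1 → Integrable (fun p => g p v) D)
    (hf : ∀ v, ‖v‖ ≤ 1 → ∫ p, g p v ∂D = f v) {a b : Param L d} (ha : ‖a‖ ≤ 1) (hb : ‖b‖ ≤ 1) :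
    |f b - f a| ≤ κ * ‖b - a‖ := by
  rw [← hf b hb, ← hf a ha, ← integral_sub (hint b hb) (hint a ha)]
  have := norm_integral_le_of_norm_le_const (μ := D) (C := κ * ‖b - a‖)
    (f := fun p => g p b - g p a) (by
      filter_upwards [hS] with p hp
      exact abs_sub_le_of_norm_gradient_le (hdiff p hp) (hκ p hp) ha hb)
  simpa using this

/-- The expected sample gradient is a subgradient of a convex expected loss, even if the sample
losses are not convex. -/
theorem integral_inner_gradientOn_le (hS : S ∈ ae D)
    (hdiff : ∀ p ∈ S, Differentiable ℝ (g p))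
    (hκ : ∀ p ∈ S, ∀ v, ‖v‖ ≤ 1 → ‖∇ (g p) v‖ ≤ κ)
    (hint : ∀ v, ‖v‖ ≤ 1 → Integrable (fun p => g p v) D)
    (hf : ∀ v, ‖v‖ ≤ 1 → ∫ p, g p v ∂D = f v) (hconv : ConvexOn ℝ (Metric.closedBall 0 1) f)
    {a b : Param L d} (ha : ‖a‖ ≤ 1) (hb : ‖b‖ ≤ 1) :
    ∫ p, inner ℝ (gradientOn S g p a) (b - a) ∂D ≤ f b - f a := by
  have ha' : a ∈ Metric.closedBall (0 : Param L d) 1 := mem_closedBall_zero_iff.2 ha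
  have hb' : b ∈ Metric.closedBall (0 : Param L d) 1 := mem_closedBall_zero_iff.2 hb
  have hseg : ∀ n : ℕ, a + ((n : ℝ) + 1)⁻¹ • (b - a) =
      (1 - ((n : ℝ) + 1)⁻¹) • a + ((n : ℝ) + 1)⁻¹ • b := fun n => by module
  have hs0 : ∀ n : ℕ, 0 ≤ ((n : ℝ) + 1)⁻¹ := fun n => by positivity
  have hs1 : ∀ n : ℕ, 0 ≤ 1 - ((n : ℝ) + 1)⁻¹ := fun n =>
    sub_nonneg.2 (inv_le_one_of_one_le₀ (by linarith [(Nat.cast_nonneg n : (0 : ℝ) ≤ n)]))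
  have hball : ∀ n : ℕ, ‖a + ((n : ℝ) + 1)⁻¹ • (b - a)‖ ≤ 1 := fun n => by
    rw [hseg]
    exact mem_closedBall_zero_iff.1
      (convex_closedBall (0 : Param L d) 1 ha' hb' (hs1 n) (hs0 n) (by ring))
  -- Dominated convergence along the segment from a to b. It stays in the ball, where the sample
  -- losses are κ-Lipschitz and their expectation equals f.
  have htend : Filter.Tendsto (fun n : ℕ => ∫ p, ((n : ℝ) + 1) *
      (g p (a + ((n : ℝ) + 1)⁻¹ • (b - a)) - g p a) ∂D) Filter.atTop
      (nhds (∫ p, inner ℝ (gradientOn S g p a) (b - a) ∂D)) := by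
    refine tendsto_integral_of_dominated_convergence (fun _ => κ * ‖b - a‖) (fun n =>
      (((hint _ (hball n)).sub (hint a ha)).const_mul _).aestronglyMeasurable)
      (integrable_const _) (fun n => ?_) ?_
    · filter_upwards [hS] with p hp
      have h1 := abs_sub_le_of_norm_gradient_le (hdiff p hp) (hκ p hp) ha (hball n)
      have hn : (0 : ℝ) < (n : ℝ) + 1 := by positivity
      rw [add_sub_cancel_left, norm_smul, Real.norm_of_nonneg (hs0 n)] at h1
      rw [norm_mul, Real.norm_of_nonneg hn.le, Real.norm_eq_abs]
      calc _ ≤ ((n : ℝ) + 1) * (κ * (((n : ℝ) + 1)⁻¹ * ‖b - a‖)) := by gcongr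
        _ = κ * ‖b - a‖ := by field_simp
    · filter_upwards [hS] with p hp
      have h1 := ((hdiff p hp a).hasFDerivAt.lim_real (b - a)).comp
        (Filter.tendsto_atTop_add_const_right _ (1 : ℝ) tendsto_natCast_atTop_atTop)
      rw [← inner_gradient] at h1
      simpa [gradientOn, hp, Function.comp_def] using h1
  -- Convexity of f bounds every difference quotient by f b - f a.
  refine le_of_tendsto htend (Filter.Eventually.of_forall fun n => ?_)
  rw [integral_const_mul, integral_sub (hint _ (hball n)) (hint a ha), hf _ (hball n), hf a ha]
  have hn : (0 : ℝ) < (n : ℝ) + 1 := by positivity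
  have h1 := hconv.2 ha' hb' (hs1 n) (hs0 n) (by ring)
  rw [← hseg, smul_eq_mul, smul_eq_mul] at h1
  have h2 : f (a + ((n : ℝ) + 1)⁻¹ • (b - a)) - f a ≤ ((n : ℝ) + 1)⁻¹ * (f b - f a) := by
    linarith
  calc _ ≤ ((n : ℝ) + 1) * (((n : ℝ) + 1)⁻¹ * (f b - f a)) := by gcongr
    _ = f b - f a := by field_simp

end Oracle

/-! ### Measurability and convexity of the risk -/

section Risk

variable {ℓ : EuclideanSpace ℝ (Fin L) → EuclideanSpace ℝ (Fin L) → ℝ}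

theorem measurable_risk (P : Measure (Example L d)) [SFinite P]
    (hℓ : Measurable (Function.uncurry ℓ)) : Measurable (risk P ℓ) := by
  have h : Measurable fun q : Param L d × Example L d => ℓ q.2.2 (model q.1 q.2.1) :=
    hℓ.comp ((measurable_snd.comp measurable_snd).prodMk
      (measurable_model.comp (measurable_fst.prodMk (measurable_fst.comp measurable_snd))))
  exact (h.stronglyMeasurable.integral_prod_right' (ν := P)).measurable

theorem measurable_weightedLoss {w : Example L d → Param L d → ℝ}
    (hℓ : Measurable (Function.uncurry ℓ)) (hw : Measurable (Function.uncurry w)) :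
    Measurable (Function.uncurry (weightedLoss w ℓ)) :=
  hw.mul (hℓ.comp ((measurable_snd.comp measurable_fst).prodMk
    (measurable_model.comp (measurable_snd.prodMk (measurable_fst.comp measurable_fst)))))

theorem convexOn_risk {P : Measure (Example L d)}
    (hconv : ∀ p ∈ P.support, ConvexOn ℝ Set.univ (ℓ p.2))
    (hint : ∀ Θ : Param L d, ‖Θ‖ ≤ 1 → Integrable (fun p => ℓ p.2 (model Θ p.1)) P) :
    ConvexOn ℝ (Metric.closedBall 0 1) (risk P ℓ : Param L d → ℝ) := by
  refine ⟨convex_closedBall _ _, fun a ha b hb s t hs ht hst => ?_⟩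
  have hab := convex_closedBall (0 : Param L d) 1 ha hb hs ht hst
  have hia := hint a (mem_closedBall_zero_iff.1 ha)
  have hib := hint b (mem_closedBall_zero_iff.1 hb)
  have hiab := hint _ (mem_closedBall_zero_iff.1 hab)
  simp only [risk, smul_eq_mul]
  rw [← integral_const_mul, ← integral_const_mul,
    ← integral_add (hia.const_mul s) (hib.const_mul t)]
  refine integral_mono_ae hiab ((hia.const_mul s).add (hib.const_mul t)) ?_
  filter_upwards [Measure.support_mem_ae (μ := P)] with p hp
  have := (hconv p hp).2 (Set.mem_univ (model a p.1)) (Set.mem_univ (model b p.1)) hs ht hst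
  rwa [← model_smul, ← model_smul, ← model_add] at this

end Risk

/-! ### Markov's inequality and the step sizes -/

theorem prob_le_ge_of_integral_le {Ω : Type*} [MeasurableSpace Ω] {μ : Measure Ω}
    [IsProbabilityMeasure μ] {h : Ω → ℝ} (hm : Measurable h) (h0 : ∀ ω, 0 ≤ h ω)
    (hi : Integrable h μ) {ε : ℝ} (hε : 0 < ε) (hle : ∫ ω, h ω ∂μ ≤ ε / 100) :
    (99 / 100 : ENNReal) ≤ μ {ω | h ω ≤ ε} := by
  have h1 := (mul_meas_ge_le_integral_of_nonneg (ae_of_all μ h0) hi ε).trans hle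
  have h2 : μ.real {ω | ε ≤ h ω} ≤ 1 / 100 := by
    refine le_of_mul_le_mul_left (h1.trans_eq (by ring)) hε
  have h3 : μ.real {ω | h ω ≤ ε}ᶜ ≤ μ.real {ω | ε ≤ h ω} :=
    measureReal_mono fun ω (hω : ¬ h ω ≤ ε) => (not_le.1 hω).le
  rw [probReal_compl_eq_one_sub (measurableSet_le hm measurable_const)] at h3
  have h4 : (99 / 100 : ℝ) ≤ μ.real {ω | h ω ≤ ε} := by linarith
  have h5 := ENNReal.ofReal_le_ofReal h4
  rw [ofReal_measureReal, ENNReal.ofReal_div_of_pos (by norm_num)] at h5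
  simpa using h5

/-- Linearly decaying step sizes for a run of length `T`. -/
noncomputable def linearDecay (κ : ℝ) (T : ℕ) (t : ℕ) : ℝ :=
  -- The maximum with 1 only keeps steps positive after time T; it is inactive for t ≤ T. When κ = 0
  -- the risk is constant on the ball, so any positive step will do.
  if κ ≤ 0 then 1 else 1 / (κ * (T * √T)) * max 1 ((T : ℝ) + 1 - t)

theorem linearDecay_pos (κ : ℝ) {T : ℕ} (hT : 1 ≤ T) (t : ℕ) : 0 < linearDecay κ T t := by
  unfold linearDecay
  split_ifs with h
  · exact one_pos
  · have hκ := not_le.1 h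
    have hT' : (0 : ℝ) < T := by exact_mod_cast hT
    have : (0 : ℝ) < max 1 ((T : ℝ) + 1 - t) := lt_max_of_lt_left one_pos
    positivity

/-- The algorithm counts from 1 and the oracle iteration from 0, hence the shift in steps and
samples. -/
theorem sgd_eq_oracleIterate {L d : ℕ} {w : Example L d → Param L d → ℝ}
    {ℓ : EuclideanSpace ℝ (Fin L) → EuclideanSpace ℝ (Fin L) → ℝ} (η : ℕ → ℝ)
    {z : ℕ → Example L d} {S : Set (Example L d)} (hz : ∀ t, z t ∈ S) (k : ℕ) :
    sgd w ℓ η z (k + 1) = oracleIterate (gradientOn S (weightedLoss w ℓ)) (fun t => η (t + 1))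
      (fun t => z (t + 1)) k := by
  induction k with
  | zero => rfl
  | succ k ih =>
    rw [sgd, oracleIterate, ih, gradientOn, Set.indicator_of_mem (hz (k + 1))]

/-- With s = √T, both terms on the right of `h` equal 1/s⁴, so a·s ≤ 2κ. The constant 40000 = 200²
gives 200κ ≤ εs. -/
theorem gap_le_of_sample_size {κ ε a : ℝ} (hκ : 0 < κ) (hε : 0 < ε) {m : ℕ}
    (hT : 40000 * (κ ^ 2 / ε ^ 2) ≤ ((m + 1 : ℕ) : ℝ))
    (h : 1 / (κ * (((m + 1 : ℕ) : ℝ) * √((m + 1 : ℕ) : ℝ))) * a ≤ 1 / ((m : ℝ) + 1) ^ 2 +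
      (m + 1) * (1 / (κ * (((m + 1 : ℕ) : ℝ) * √((m + 1 : ℕ) : ℝ)))) ^ 2 * κ ^ 2) :
    a ≤ ε / 100 := by
  push_cast at h hT
  obtain ⟨s, hs⟩ : ∃ s, s = √((m : ℝ) + 1) := ⟨_, rfl⟩
  have hs0 : 0 < s := hs ▸ Real.sqrt_pos.2 (by positivity)
  have hs2 : (m : ℝ) + 1 = s ^ 2 := by rw [hs, Real.sq_sqrt (by positivity)]
  rw [← hs, hs2] at h
  rw [hs2] at hT
  have h1 : a * s ≤ 2 * κ := by
    have h2 : 1 / (s ^ 2) ^ 2 + s ^ 2 * (1 / (κ * (s ^ 2 * s))) ^ 2 * κ ^ 2 = 2 / s ^ 4 := by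
      field_simp
      ring
    have h3 : 1 / (κ * (s ^ 2 * s)) * a = (a * s) / κ / s ^ 4 := by field_simp
    rw [h2, h3, div_le_div_iff_of_pos_right (by positivity), div_le_iff₀ hκ] at h
    exact h
  have h2 : 200 * κ ≤ ε * s := by
    refine le_of_sq_le_sq ?_ (by positivity)
    rw [← mul_div_assoc, div_le_iff₀ (by positivity)] at hT
    linarith
  refine le_of_mul_le_mul_right (h1.trans ?_) hs0
  linarith

end ReweightedSGD

/-! ### Assembly -/

theorem mainTheorem6 :
    ∃ C : ℝ, 0 < C ∧
    ∀ (c : ReweightedSGD.RegularityParams) (T : ℕ), 1 ≤ T →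
    ∃ η : ℕ → ℝ, (∀ t, 0 < η t) ∧
    ∀ (ε : ℝ), 0 < ε → C * (c.kappa ^ 2 / ε ^ 2) ≤ (T : ℝ) →
    ∀ (L d : ℕ)
      (X : Measure (EuclideanSpace ℝ (Fin d))) [IsProbabilityMeasure X]
      (fTrue : EuclideanSpace ℝ (Fin d) → EuclideanSpace ℝ (Fin L)) (_ : Measurable fTrue)
      (D : Measure (ReweightedSGD.Example L d)) (_ : D.map Prod.fst = X)
      (ℓ : EuclideanSpace ℝ (Fin L) → EuclideanSpace ℝ (Fin L) → ℝ)
      (_ : Measurable (Function.uncurry ℓ))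
      (w : ReweightedSGD.Example L d → ReweightedSGD.Param L d → ℝ)
      (_ : Measurable (Function.uncurry w))
      (_ : ReweightedSGD.RegularityAssumptions c X (ReweightedSGD.cleanDist X fTrue) D ℓ w)
      (_ : ReweightedSGD.IsDebiasing (ReweightedSGD.cleanDist X fTrue) D w ℓ)
      (Ω : Type*) [MeasurableSpace Ω] (μ : Measure Ω) [IsProbabilityMeasure μ]
      (Z : ℕ → Ω → ReweightedSGD.Example L d) (_ : ∀ t, Measurable (Z t))
      (_ : ∀ t, μ.map (Z t) = D) (_ : iIndepFun Z μ),
    ∃ Θmin : ReweightedSGD.Param L d, ‖Θmin‖ ≤ 1 ∧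
      (∀ Θ : ReweightedSGD.Param L d, ‖Θ‖ ≤ 1 →
        ReweightedSGD.risk (ReweightedSGD.cleanDist X fTrue) ℓ Θmin ≤
          ReweightedSGD.risk (ReweightedSGD.cleanDist X fTrue) ℓ Θ) ∧
      (99 / 100 : ENNReal) ≤ μ {ω |
        ReweightedSGD.risk (ReweightedSGD.cleanDist X fTrue) ℓ
            (ReweightedSGD.sgd w ℓ η (fun t => Z t ω) T) ≤
          ReweightedSGD.risk (ReweightedSGD.cleanDist X fTrue) ℓ Θmin + ε} := by
  refine ⟨40000, by norm_num, fun c T hT => ⟨ReweightedSGD.linearDecay c.kappa T,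
    ReweightedSGD.linearDecay_pos c.kappa hT, ?_⟩⟩
  intro ε hε hTε L d X _ fTrue hfTrue D hDX ℓ hℓ w hw hreg hdeb Ω _ μ _ Z hZ hlaw hind
  have : IsProbabilityMeasure D := hlaw 0 ▸ Measure.isProbabilityMeasure_map (hZ 0).aemeasurable
  have : IsProbabilityMeasure (ReweightedSGD.cleanDist X fTrue) :=
    Measure.isProbabilityMeasure_map (measurable_id.prodMk hfTrue).aemeasurable
  obtain ⟨f, hf⟩ : ∃ f : ReweightedSGD.Param L d → ℝ,
      f = ReweightedSGD.risk (ReweightedSGD.cleanDist X fTrue) ℓ := ⟨_, rfl⟩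
  have hfm : Measurable f := hf ▸ ReweightedSGD.measurable_risk _ hℓ
  have hconv : ConvexOn ℝ (Metric.closedBall 0 1) f := hf ▸ ReweightedSGD.convexOn_risk
    (fun p hp => hreg.loss_convex p (Or.inl hp)) fun Θ hΘ => (hdeb Θ hΘ).1
  have hS : D.support ∈ ae D := Measure.support_mem_ae
  have hdiff : ∀ p ∈ D.support, Differentiable ℝ (ReweightedSGD.weightedLoss w ℓ p) :=
    fun p hp Θ => (ReweightedSGD.hasFDerivAt_weightedLoss
      (hreg.weight_regular p hp).differentiable
      (hreg.loss_regular p hp).differentiable Θ).differentiableAt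
  have hκ : ∀ p ∈ D.support, ∀ v, ‖v‖ ≤ 1 →
      ‖∇ (ReweightedSGD.weightedLoss w ℓ p) v‖ ≤ c.kappa := fun p hp v hv =>
    ReweightedSGD.norm_gradient_weightedLoss_le (hreg.weight_regular p hp)
      (hreg.loss_regular p hp)
      (hreg.features_bounded _ (hDX ▸ ReweightedSGD.fst_mem_support_map hp)) hv
  have hint : ∀ v, ‖v‖ ≤ 1 → Integrable (fun p => ReweightedSGD.weightedLoss w ℓ p v) D :=
    fun v hv => (hdeb v hv).2.1
  have hfe : ∀ v, ‖v‖ ≤ 1 → ∫ p, ReweightedSGD.weightedLoss w ℓ p v ∂D = f v :=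
    fun v hv => hf ▸ (hdeb v hv).2.2
  -- A probability measure here has nonempty support, and κ bounds a norm at any point of it.
  have hκ0 : 0 ≤ c.kappa := by
    obtain ⟨p, hp⟩ := Measure.nonempty_support (IsProbabilityMeasure.ne_zero D)
    exact (norm_nonneg _).trans (hκ p hp 0 (by simp))
  have hlip : ∀ a b : ReweightedSGD.Param L d, ‖a‖ ≤ 1 → ‖b‖ ≤ 1 →
      |f b - f a| ≤ c.kappa * ‖b - a‖ := fun a b ha hb =>
    ReweightedSGD.abs_expectation_sub_le hS hdiff hκ hint hfe ha hb
  have hcont : ContinuousOn f (Metric.closedBall 0 1) := by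
    refine (LipschitzOnWith.of_dist_le_mul (K := ⟨c.kappa, hκ0⟩) fun a ha b hb => ?_).continuousOn
    rw [dist_eq_norm, dist_eq_norm]
    exact hlip b a (mem_closedBall_zero_iff.1 hb) (mem_closedBall_zero_iff.1 ha)
  obtain ⟨u, hu, humin⟩ := (isCompact_closedBall (0 : ReweightedSGD.Param L d) 1).exists_isMinOn
    ⟨0, by simp⟩ hcont
  have hu := mem_closedBall_zero_iff.1 hu
  have hmin : ∀ v, ‖v‖ ≤ 1 → f u ≤ f v := fun v hv => humin (mem_closedBall_zero_iff.2 hv)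
  rw [← hf]
  refine ⟨u, hu, hmin, ?_⟩
  obtain ⟨m, rfl⟩ : ∃ m, T = m + 1 := ⟨T - 1, by omega⟩
  obtain ⟨G, hG⟩ : ∃ G, G = ReweightedSGD.gradientOn D.support (ReweightedSGD.weightedLoss w ℓ) :=
    ⟨_, rfl⟩
  obtain ⟨η, hη⟩ : ∃ η, η = ReweightedSGD.linearDecay c.kappa (m + 1) := ⟨_, rfl⟩
  rw [← hη]
  have hGm : Measurable (Function.uncurry G) := hG ▸ ReweightedSGD.measurable_gradientOn
    Measure.isClosed_support.measurableSet (ReweightedSGD.measurable_weightedLoss hℓ hw) hdiff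
  -- Almost surely all samples lie in the support, where the truncated oracle is the true gradient.
  have hae : ∀ᵐ ω ∂μ, ReweightedSGD.sgd w ℓ η (fun t => Z t ω) (m + 1) =
      ReweightedSGD.oracleIterate G (fun t => η (t + 1)) (fun t => Z (t + 1) ω) m := by
    have h1 : ∀ᵐ ω ∂μ, ∀ t, Z t ω ∈ D.support := ae_all_iff.2 fun t =>
      ae_of_ae_map (hZ t).aemeasurable (by rw [hlaw t]; exact hS)
    filter_upwards [h1] with ω hω
    rw [ReweightedSGD.sgd_eq_oracleIterate η hω m, hG]
  have hset : μ {ω | f (ReweightedSGD.sgd w ℓ η (fun t => Z t ω) (m + 1)) ≤ f u + ε} =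
      μ {ω | f (ReweightedSGD.oracleIterate G (fun t => η (t + 1)) (fun t => Z (t + 1) ω) m)
        - f u ≤ ε} := by
    refine measure_congr ?_
    filter_upwards [hae] with ω hω
    refine propext ?_
    change f _ ≤ f u + ε ↔ f _ - f u ≤ ε
    rw [hω, sub_le_iff_le_add']
  rw [hset]
  have hx1 : ∀ ω, ‖ReweightedSGD.oracleIterate G (fun t => η (t + 1))
      (fun t => Z (t + 1) ω) m‖ ≤ 1 := fun ω => ReweightedSGD.norm_oracleIterate_le _ _ _ _
  have hxm : Measurable fun ω => ReweightedSGD.oracleIterate G (fun t => η (t + 1))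
      (fun t => Z (t + 1) ω) m := measurable_fst.comp
    ((ReweightedSGD.measurable_past (Z := fun t => Z (t + 1)) hGm (fun t => η (t + 1)) m u m).mono
      (iSup₂_le fun i _ => (hZ (i + 1)).comap_le) le_rfl)
  have hbd : ∀ v, ‖v‖ ≤ 1 → |f v| ≤ |f 0| + c.kappa := fun v hv => by
    have h1 := hlip 0 v (by simp) hv
    rw [sub_zero] at h1
    have h2 := abs_sub_abs_le_abs_sub (f v) (f 0)
    have h3 := mul_le_of_le_one_right hκ0 hv
    linarith
  have hfi : Integrable (fun ω => f (ReweightedSGD.oracleIterate G (fun t => η (t + 1))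
      (fun t => Z (t + 1) ω) m)) μ :=
    Integrable.of_bound (hfm.comp hxm).aestronglyMeasurable (|f 0| + c.kappa)
      (ae_of_all _ fun ω => hbd _ (hx1 ω))
  refine ReweightedSGD.prob_le_ge_of_integral_le ((hfm.comp hxm).sub_const _)
    (fun ω => sub_nonneg.2 (hmin _ (hx1 ω))) (hfi.sub (integrable_const _)) hε ?_
  simp only [Function.comp_apply]
  rw [integral_sub hfi (integrable_const _), integral_const, probReal_univ, one_smul]
  rcases hκ0.eq_or_lt with hκz | hκpos
  · have h1 : ∀ v, ‖v‖ ≤ 1 → f v = f u := fun v hv => by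
      have := hlip u v hu hv
      rw [← hκz, zero_mul] at this
      exact sub_eq_zero.1 (abs_nonpos_iff.1 this)
    simp only [h1 _ (hx1 _), integral_const, probReal_univ, one_smul, sub_self]
    positivity
  · refine ReweightedSGD.gap_le_of_sample_size hκpos hε hTε ?_
    refine ReweightedSGD.expected_last_gap_le (Z := fun t => Z (t + 1)) (fun t => hZ _)
      (fun t => hlaw _) (hind.precomp (add_left_injective 1)) hGm
      (fun p v hv => hG ▸ ReweightedSGD.norm_gradientOn_le hκ0 hκ p hv) hfm hbd hconv
      (fun a b ha hb => hG ▸ ReweightedSGD.integral_inner_gradientOn_le hS hdiff hκ hint hfe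
        hconv ha hb) hu hmin m (by positivity) fun k hk => ?_
    have hkm : (k : ℝ) ≤ m := by exact_mod_cast hk
    rw [hη, ReweightedSGD.linearDecay, if_neg (not_le.2 hκpos)]
    congr 1
    push_cast
    rw [max_eq_right (by linarith)]
    ring
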